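/- Let $k$ be a field and let $A$ be a profinite $k$-algebra, i.e. an (associative, unital) $k$-algebra isomorphic to the inverse limit, over a directed index set, of finite dimensional $k$-algebras. Then the following twelve conditions are equivalent: (i) $A$ is left PF: every faithful left $A$-module $M$ generates the category of left $A$-modules (every left $A$-module is a quotient of a direct sum of copies of $M$); (ii) $A$ is right PF; (iii) $A$ is a left cogenerator: every left $A$-module embeds in a product of copies of $A$; (iv) $A$ is a right cogenerator; (v) $A$ is a QF (quasi-Frobenius) ring: $A$ is left or right self-injective, and left or right artinian; (vi) $A$ is finite dimensional over $k$ and is a QF ring; (vii) $A$ is left FGF: every finitely generated left $A$-module embeds in a free left $A$-module; (viii) $A$ is right FGF; (ix) $A$ is left CF: every cyclic left $A$-module embeds in a free left $A$-module; (x) $A$ is right CF; (xi) $A$ is a left D-ring: every left ideal of $A$ is the left annihilator $\{r\in A : rx=0 \text{ for all } x\in X\}$ of some subset $X\subseteq A$; (xii) $A$ is a right D-ring. Here the right-handed conditions are the left-handed conditions for the opposite ring of $A$. -/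

import Mathlib

universe u v

/-! ### Profinite algebras -/

/-- The inverse limit of a system of `k`-algebras `B i`, indexed by a preorder, with transition
maps `f : B j → B i` for `i ≤ j`: the subalgebra of compatible families in `∏ i, B i`. -/
def algInverseLimit (k : Type v) [Field k] {ι : Type u} [Preorder ι] (B : ι → Type u)
    [∀ i, Ring (B i)] [∀ i, Algebra k (B i)] (f : ∀ ⦃i j : ι⦄, i ≤ j → B j →ₐ[k] B i) :
    Subalgebra k (∀ i, B i) where
  carrier := {x | ∀ ⦃i j : ι⦄ (h : i ≤ j), f h (x j) = x i}
  mul_mem' := fun hx hy i j h => by simp [hx h, hy h]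
  add_mem' := fun hx hy i j h => by simp [hx h, hy h]
  algebraMap_mem' := fun r i j h => by simp

/-- A `k`-algebra is profinite if it is isomorphic to the inverse limit of an inverse system,
over a directed index set, of finite dimensional `k`-algebras. -/
def IsProfiniteAlgebra (k : Type v) (A : Type u) [Field k] [Ring A] [Algebra k A] : Prop :=
  ∃ (ι : Type u) (_ : Preorder ι) (_ : IsDirectedOrder ι) (_ : Nonempty ι)
    (B : ι → Type u) (_ : ∀ i, Ring (B i)) (_ : ∀ i, Algebra k (B i))
    (f : ∀ ⦃i j : ι⦄, i ≤ j → B j →ₐ[k] B i),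
    (∀ i, Module.Finite k (B i)) ∧
    InverseSystem (fun (i j : ι) (h : i ≤ j) => (f h : B j → B i)) ∧
    Nonempty (A ≃ₐ[k] algInverseLimit k B f)

/-! ### Ring-theoretic notions

In Mathlib a `Module R M` is a left module, and right `R`-modules are left modules over the
opposite ring `Rᵐᵒᵖ`; right ideals of `R` are left ideals of `Rᵐᵒᵖ`. So each right-handed notion
for `R` is the left-handed notion for `Rᵐᵒᵖ`. -/

/-- The left module `M` generates the category of left `R`-modules: every left `R`-module is a
quotient of a direct sum of copies of `M`. -/
def IsGeneratorModule (R : Type u) [Ring R] (M : Type u) [AddCommGroup M] [Module R M] : Prop :=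
  ∀ (N : Type u) [AddCommGroup N] [Module R N],
    ∃ (ι : Type u) (g : (ι →₀ M) →ₗ[R] N), Function.Surjective g

/-- `R` is left pseudo-Frobenius (PF): every faithful left `R`-module generates the category of
left `R`-modules. -/
def IsLeftPF (R : Type u) [Ring R] : Prop :=
  ∀ (M : Type u) [AddCommGroup M] [Module R M] [FaithfulSMul R M], IsGeneratorModule R M

/-- `R` is right PF. -/
def IsRightPF (R : Type u) [Ring R] : Prop := IsLeftPF Rᵐᵒᵖ

/-- `R` is a left cogenerator: every left `R`-module embeds in a product of copies of `R`. -/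
def IsLeftCogenerator (R : Type u) [Ring R] : Prop :=
  ∀ (M : Type u) [AddCommGroup M] [Module R M],
    ∃ (ι : Type u) (g : M →ₗ[R] (ι → R)), Function.Injective g

/-- `R` is a right cogenerator. -/
def IsRightCogenerator (R : Type u) [Ring R] : Prop := IsLeftCogenerator Rᵐᵒᵖ

/-- The left `R`-module `M` embeds in a free left `R`-module. -/
def EmbedsInFree (R : Type u) [Ring R] (M : Type u) [AddCommGroup M] [Module R M] : Prop :=
  ∃ (ι : Type u) (g : M →ₗ[R] (ι →₀ R)), Function.Injective g

/-- `R` is left FGF: every finitely generated left `R`-module embeds in a free one. -/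
def IsLeftFGF (R : Type u) [Ring R] : Prop :=
  ∀ (M : Type u) [AddCommGroup M] [Module R M] [Module.Finite R M], EmbedsInFree R M

/-- `R` is right FGF. -/
def IsRightFGF (R : Type u) [Ring R] : Prop := IsLeftFGF Rᵐᵒᵖ

/-- `R` is left CF: every cyclic left `R`-module embeds in a free one. -/
def IsLeftCF (R : Type u) [Ring R] : Prop :=
  ∀ (M : Type u) [AddCommGroup M] [Module R M],
    (∃ m : M, Submodule.span R {m} = ⊤) → EmbedsInFree R M

/-- `R` is right CF. -/
def IsRightCF (R : Type u) [Ring R] : Prop := IsLeftCF Rᵐᵒᵖ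

/-- `R` is a left D-ring: every left ideal is the left annihilator of some subset of `R`. -/
def IsLeftDRing (R : Type u) [Ring R] : Prop :=
  ∀ I : Ideal R, ∃ X : Set R, ∀ r : R, r ∈ I ↔ ∀ x ∈ X, r * x = 0

/-- `R` is a right D-ring. -/
def IsRightDRing (R : Type u) [Ring R] : Prop := IsLeftDRing Rᵐᵒᵖ

/-- `R` is quasi-Frobenius (QF): it is left or right self-injective, and left or right artinian. -/
def IsQF (R : Type u) [Ring R] : Prop :=
  (Module.Injective R R ∨ Module.Injective Rᵐᵒᵖ Rᵐᵒᵖ) ∧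
    (IsArtinianRing R ∨ IsArtinianRing Rᵐᵒᵖ)

/-!
For a profinite algebra, each of the twelve conditions forces finite dimensionality, and among
finite dimensional algebras all of them say that `A` is self-injective.

**Finite dimensionality.** The cogenerator, FGF and CF conditions all imply the D-ring condition. In
a left D-ring every left ideal is an annihilator, hence cut out by continuous functionals, and the
duality between `A` and its space of continuous functionals excludes infinite strictly increasing
chains of left ideals (`IsLeftDRing.isNoetherianRing`). The right annihilators of the open ideals
`Iᵢ` then have a largest member, whose `Iᵢ` is contained in all the others, hence zero
(`IsLeftDRing.module_finite`). If `A` is left PF, the faithful module `⨁ A ⧸ Iᵢ` generates `A`, and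
again some `Iᵢ` vanishes (`IsLeftPF.module_finite`). For artinian `A` a minimal `Iᵢ` is zero.

**Left D-rings are left self-injective** (`IsLeftDRing.injective`), for finite dimensional `A`. For
each simple module `S`, a largest cyclic module with essential simple socle `S` embeds in `A` as a
direct summand. This gives one indecomposable projective for each isomorphism class of socles;
their tops are again pairwise non-isomorphic, so by counting every simple module is one of the tops
(`IsLeftDRing.exists_isBasicFamily`). The sum `ε` of the corresponding orthogonal idempotents is
full, and a functional `φ` which is nonzero on the socles makes `(x, y) ↦ φ (y x)` a pairing of
`A ε` and `ε A`. It has trivial left radical; comparing dimensions on `ε A ε` shows that it is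
perfect (`exists_representing_element`). So `A ε` is the dual of the projective right module `ε A`,
hence injective, and so is `A`, because `ε` is full.

**Symmetry.** A left self-injective ring with finitely generated right ideals is a right D-ring
(`isLeftDRing_op_of_injective`), so the previous step, applied to the opposite algebra, carries
self-injectivity from one side to the other. A left artinian left self-injective left D-ring is
left PF, a left cogenerator and left FGF.
-/

/-! ### Annihilators, embeddings and self-injectivity over arbitrary rings -/

section GeneralRings

variable {R : Type u} [Ring R]

theorem IsLeftFGF.isLeftCF (h : IsLeftFGF R) : IsLeftCF R := by
  intro M _ _ ⟨m, hm⟩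
  have : Module.Finite R M := ⟨⟨{m}, by simpa using hm⟩⟩
  exact h M

theorem IsLeftCogenerator.isLeftDRing (h : IsLeftCogenerator R) : IsLeftDRing R := by
  intro I
  obtain ⟨ι, g, hg⟩ := h (R ⧸ I)
  refine ⟨Set.range (g (I.mkQ 1)), fun r => ?_⟩
  have key : g (I.mkQ r) = r • g (I.mkQ 1) := by rw [← map_smul, ← map_smul]; simp
  rw [Set.forall_mem_range, ← Submodule.Quotient.mk_eq_zero, ← Submodule.mkQ_apply,
    ← map_eq_zero_iff g hg, key, funext_iff]
  simp

theorem IsLeftCF.isLeftDRing (h : IsLeftCF R) : IsLeftDRing R := by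
  intro I
  obtain ⟨ι, g, hg⟩ := h (R ⧸ I) ⟨I.mkQ 1, by
    rw [eq_top_iff]
    rintro x -
    obtain ⟨r, rfl⟩ := I.mkQ_surjective x
    exact Submodule.mem_span_singleton.2 ⟨r, by rw [← map_smul]; simp⟩⟩
  refine ⟨Set.range (g (I.mkQ 1)), fun r => ?_⟩
  have key : g (I.mkQ r) = r • g (I.mkQ 1) := by rw [← map_smul, ← map_smul]; simp
  rw [Set.forall_mem_range, ← Submodule.Quotient.mk_eq_zero, ← Submodule.mkQ_apply,
    ← map_eq_zero_iff g hg, key, DFunLike.ext_iff]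
  simp

theorem IsLeftDRing.of_ringEquiv {S : Type u} [Ring S] (e : R ≃+* S) (h : IsLeftDRing R) :
    IsLeftDRing S := by
  intro I
  obtain ⟨X, hX⟩ := h (I.comap (e : R →+* S))
  refine ⟨e '' X, fun s => ?_⟩
  have := hX (e.symm s)
  simp only [Ideal.mem_comap, RingHom.coe_coe, RingEquiv.apply_symm_apply] at this
  rw [this, Set.forall_mem_image]
  refine forall₂_congr fun x _ => ?_
  rw [← map_eq_zero_iff e e.injective, map_mul, RingEquiv.apply_symm_apply]

/-- In a left D-ring, elements outside a left ideal are detected by right multiplications that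
kill the ideal. -/
theorem IsLeftDRing.exists_mul_ne_zero (h : IsLeftDRing R) {I : Ideal R} {a : R} (ha : a ∉ I) :
    ∃ x, (∀ r ∈ I, r * x = 0) ∧ a * x ≠ 0 := by
  obtain ⟨X, hX⟩ := h I
  rw [hX] at ha
  push Not at ha
  obtain ⟨x, hx, hax⟩ := ha
  exact ⟨x, fun r hr => (hX r).1 hr x hx, hax⟩

/-- A left PF ring is left self-injective: an injective module `E` containing `R` is faithful, so
it generates `R`; a map from a left ideal to `R` is then extended coordinatewise in `E`, using a
preimage of `1` in the direct sum of copies of `E`. -/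
theorem IsLeftPF.injective (h : IsLeftPF R) : Module.Injective R R := by
  obtain ⟨⟨E, hE, f, hf⟩⟩ :=
    CategoryTheory.EnoughInjectives.presentation (ModuleCat.of R R)
  have hfi : Function.Injective f.hom := (ModuleCat.mono_iff_injective f).1 hf
  have hEi : Module.Injective R E := (Module.injective_iff_injective_object R E).2 hE
  have : FaithfulSMul R E := ⟨fun {a b} hab => by
    have := hab (f.hom (1 : R))
    rw [← map_smul, ← map_smul] at this
    simpa using hfi this⟩
  obtain ⟨J, g, hg⟩ := h E R
  obtain ⟨y, hy⟩ := hg 1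
  apply Module.Baer.injective
  intro I φ
  have hb := Module.Baer.of_injective hEi
  choose ψ hψ using fun j => hb I ((LinearMap.toSpanSingleton R E (y j)).comp φ)
  refine ⟨LinearMap.toSpanSingleton R R (g (∑ j ∈ y.support, Finsupp.single j (ψ j 1))),
    fun a ha => ?_⟩
  have h1 : a • (∑ j ∈ y.support, Finsupp.single j (ψ j 1)) = φ ⟨a, ha⟩ • y := by
    conv_rhs => rw [← Finsupp.sum_single y, Finsupp.sum, Finset.smul_sum]
    rw [Finset.smul_sum]
    refine Finset.sum_congr rfl fun j _ => ?_
    rw [Finsupp.smul_single, Finsupp.smul_single, ← map_smul, smul_eq_mul, mul_one, hψ j a ha]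
    simp
  rw [LinearMap.toSpanSingleton_apply, ← map_smul, h1, map_smul, hy, smul_eq_mul, mul_one]

/-- If `R` is left self-injective, every finitely generated right ideal `∑ tᵢ R` is a right
annihilator: if `a` is killed by the left annihilator of the `tᵢ`, then `(r tᵢ)ᵢ ↦ r a` is a
well defined map from a submodule of a free module, and an extension of it to the whole free
module writes `a` as `∑ tᵢ zᵢ`. -/
theorem isLeftDRing_op_of_injective [IsNoetherianRing Rᵐᵒᵖ] (h : Module.Injective R R) :
    IsLeftDRing Rᵐᵒᵖ := by
  classical
  intro I
  obtain ⟨s, hs⟩ := IsNoetherian.noetherian I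
  refine ⟨{x | ∀ r ∈ I, r * x = 0}, fun r => ⟨fun hr x hx => hx r hr, fun hr => ?_⟩⟩
  let Φ : R →ₗ[R] (s → R) := LinearMap.pi fun t => LinearMap.toSpanSingleton R R t.1.unop
  have hker : LinearMap.ker Φ ≤ LinearMap.ker (LinearMap.toSpanSingleton R R r.unop) := by
    intro b hb
    have hb' : ∀ t ∈ s, t * MulOpposite.op b = 0 := fun t ht => by
      have := congrFun (LinearMap.mem_ker.1 hb) ⟨t, ht⟩
      apply MulOpposite.unop_injective
      simpa [Φ] using this
    have := hr (MulOpposite.op b) fun q hq => by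
      have : I ≤ LinearMap.ker (LinearMap.toSpanSingleton Rᵐᵒᵖ Rᵐᵒᵖ (MulOpposite.op b)) := by
        rw [← hs, Submodule.span_le]
        intro t ht
        simpa using hb' t ht
      simpa using this hq
    simpa using congrArg MulOpposite.unop this
  obtain ⟨H, hH⟩ := h.out ((LinearMap.ker Φ).liftQ Φ le_rfl)
    (LinearMap.ker_eq_bot.1 (Submodule.ker_liftQ_eq_bot _ _ _ le_rfl))
    ((LinearMap.ker Φ).liftQ _ hker)
  have h1 := hH ((LinearMap.ker Φ).mkQ 1)
  simp only [Submodule.mkQ_apply, Submodule.liftQ_apply, LinearMap.toSpanSingleton_apply,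
    one_smul] at h1
  have h2 : r = ∑ t : s, MulOpposite.op (H (Pi.single t 1)) * t.1 := by
    apply MulOpposite.unop_injective
    rw [← h1, LinearMap.pi_apply_eq_sum_univ H, Finset.unop_sum]
    refine Finset.sum_congr rfl fun t _ => ?_
    have h3 : (Pi.single t (1 : R) : s → R) = fun j => if t = j then 1 else 0 := by
      ext j
      simp [Pi.single_apply, eq_comm]
    simp [Φ, h3]
  rw [h2]
  refine I.sum_mem fun t _ => I.mul_mem_left _ ?_
  rw [← hs]
  exact Submodule.subset_span t.2

/-- Over a left self-injective left D-ring, every nonzero element of a module is detected by a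
linear functional. -/
theorem IsLeftDRing.exists_functional_ne_zero (h : IsLeftDRing R) (hi : Module.Injective R R)
    {M : Type u} [AddCommGroup M] [Module R M] {m : M} (hm : m ≠ 0) :
    ∃ f : M →ₗ[R] R, f m ≠ 0 := by
  let T := LinearMap.toSpanSingleton R M m
  obtain ⟨x, hx, hx1⟩ := h.exists_mul_ne_zero (I := LinearMap.ker T) (a := 1) (by simpa [T])
  have hle : LinearMap.ker T ≤ LinearMap.ker (LinearMap.toSpanSingleton R R x) := fun b hb => by
    simpa using hx b hb
  obtain ⟨H, hH⟩ := hi.out ((LinearMap.ker T).liftQ T le_rfl)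
    (LinearMap.ker_eq_bot.1 (Submodule.ker_liftQ_eq_bot _ _ _ le_rfl))
    ((LinearMap.ker T).liftQ _ hle)
  refine ⟨H, ?_⟩
  have h1 := hH ((LinearMap.ker T).mkQ 1)
  simp only [Submodule.mkQ_apply, Submodule.liftQ_apply, LinearMap.toSpanSingleton_apply,
    one_smul, T] at h1
  rw [h1]
  simpa using hx1

theorem IsLeftDRing.isLeftCogenerator (h : IsLeftDRing R) (hi : Module.Injective R R) :
    IsLeftCogenerator R := by
  intro M _ _
  refine ⟨M →ₗ[R] R, LinearMap.pi fun f => f, ?_⟩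
  rw [← LinearMap.ker_eq_bot, LinearMap.ker_eq_bot']
  intro m hm
  by_contra hne
  obtain ⟨f, hf⟩ := h.exists_functional_ne_zero hi hne
  exact hf (congrFun hm f)

/-- In an artinian module, a family of submodules with trivial intersection has a finite
subfamily with trivial intersection. -/
theorem IsArtinian.exists_finset_iInf_eq_bot {M : Type*} [AddCommGroup M] [Module R M]
    [IsArtinian R M] {ι : Type*} (N : ι → Submodule R M) (h : ⨅ i, N i = ⊥) :
    ∃ s : Finset ι, ∀ x, (∀ i ∈ s, x ∈ N i) → x = 0 := by
  obtain ⟨s, hs⟩ := Finset.exists_inf_le N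
  refine ⟨s, fun x hx => ?_⟩
  have : s.inf N ≤ ⨅ i, N i := le_iInf fun i => hs i
  rw [h] at this
  have hx' : x ∈ s.inf N := by simpa [Submodule.mem_finsetInf] using hx
  simpa using this hx'

theorem IsLeftDRing.isLeftFGF [IsArtinianRing R] (h : IsLeftDRing R)
    (hi : Module.Injective R R) : IsLeftFGF R := by
  intro M _ _ _
  obtain ⟨s, hs⟩ := IsArtinian.exists_finset_iInf_eq_bot
    (fun f : M →ₗ[R] R => LinearMap.ker f) (by
      rw [eq_bot_iff]
      intro m hm
      by_contra hne
      obtain ⟨f, hf⟩ := h.exists_functional_ne_zero hi hne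
      exact hf ((Submodule.mem_iInf _).1 hm f))
  refine ⟨s, (Finsupp.linearEquivFunOnFinite R R s).symm.toLinearMap.comp
    (LinearMap.pi fun f => f.1), ?_⟩
  rw [LinearMap.coe_comp]
  refine (LinearEquiv.injective _).comp ?_
  rw [← LinearMap.ker_eq_bot, LinearMap.ker_eq_bot']
  exact fun m hm => hs m fun f hf => congrFun hm ⟨f, hf⟩

/-- Over a left artinian left self-injective ring, a faithful module `M` contains `R` in a finite
power; by injectivity this inclusion splits, so `M` generates `R`. -/
theorem isLeftPF_of_injective [IsArtinianRing R] (hi : Module.Injective R R) : IsLeftPF R := by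
  classical
  intro M _ _ _ N _ _
  obtain ⟨s, hs⟩ := IsArtinian.exists_finset_iInf_eq_bot
    (fun m : M => LinearMap.ker (LinearMap.toSpanSingleton R M m)) (by
      rw [eq_bot_iff]
      intro a ha
      rw [Submodule.mem_bot]
      refine FaithfulSMul.eq_of_smul_eq_smul (α := M) fun m => ?_
      simpa using (Submodule.mem_iInf _).1 ha m)
  let Φ : R →ₗ[R] (s → M) := LinearMap.pi fun m => LinearMap.toSpanSingleton R M m.1
  have hΦ : Function.Injective Φ := by
    rw [← LinearMap.ker_eq_bot, LinearMap.ker_eq_bot']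
    intro a ha
    exact hs a fun m hm => by simpa [Φ] using congrFun ha ⟨m, hm⟩
  obtain ⟨H, hH⟩ := hi.out Φ hΦ LinearMap.id
  let G : ((s × N) →₀ M) →ₗ[R] N := Finsupp.lsum ℕ fun p =>
    (LinearMap.toSpanSingleton R N p.2).comp (H.comp (LinearMap.single R (fun _ => M) p.1))
  refine ⟨s × N, G, fun n => ⟨∑ m : s, Finsupp.single (m, n) m.1, ?_⟩⟩
  have h1 : ∑ m : s, H (Pi.single m m.1) = 1 := by
    rw [← map_sum]
    have h2 : ∑ m : s, Pi.single m m.1 = Φ 1 := by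
      ext m
      simp [Φ, Finset.sum_apply, Pi.single_apply]
    rw [h2, hH, LinearMap.id_apply]
  have h2 : ∀ m : s, G (Finsupp.single (m, n) m.1) = H (Pi.single m m.1) • n := fun m => by
    simp [G]
  rw [map_sum, Finset.sum_congr rfl fun m _ => h2 m, ← Finset.sum_smul, h1, one_smul]

end GeneralRings

/-! ### Modules with an essential simple submodule -/

section EssentialSimple

variable {R : Type u} [Ring R] {M N P : Type*} [AddCommGroup M] [Module R M] [AddCommGroup N]
  [Module R N] [AddCommGroup P] [Module R P]

/-- `T` is a simple submodule of `M` contained in every nonzero submodule of `M`. -/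
structure IsEssentialSimple (T : Submodule R M) : Prop where
  simple : IsSimpleModule R T
  le_of_ne_bot : ∀ L : Submodule R M, L ≠ ⊥ → T ≤ L

theorem IsEssentialSimple.injective {T : Submodule R M} (hT : IsEssentialSimple T)
    (f : M →ₗ[R] N) {t : M} (ht : t ∈ T) (hft : f t ≠ 0) : Function.Injective f := by
  rw [← LinearMap.ker_eq_bot]
  by_contra hne
  exact hft (hT.le_of_ne_bot _ hne ht)

theorem IsEssentialSimple.exists_ne_zero {T : Submodule R M} (hT : IsEssentialSimple T) :
    ∃ t ∈ T, t ≠ 0 := by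
  have := hT.simple
  have := IsSimpleModule.nontrivial R T
  obtain ⟨t, ht⟩ := exists_ne (0 : T)
  exact ⟨t, t.2, by simpa using ht⟩

/-- A nonzero map from a simple module to a module with essential simple submodule `T` is an
isomorphism onto `T`. -/
theorem IsEssentialSimple.range_eq {T : Submodule R M} (hT : IsEssentialSimple T)
    [IsSimpleModule R N] {f : N →ₗ[R] M} (hf : f ≠ 0) :
    Function.Injective f ∧ LinearMap.range f = T := by
  have hinj : Function.Injective f := (LinearMap.injective_or_eq_zero f).resolve_right hf
  refine ⟨hinj, ?_⟩
  have hle : T ≤ LinearMap.range f :=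
    hT.le_of_ne_bot _ (by rwa [Ne, LinearMap.range_eq_bot])
  have h1 : IsSimpleModule R (LinearMap.range f) :=
    IsSimpleModule.congr (LinearEquiv.ofInjective f hinj).symm
  obtain ⟨t, ht, ht0⟩ := hT.exists_ne_zero
  have h2 : IsAtom (LinearMap.range f) := isSimpleModule_iff_isAtom.1 h1
  refine (h2.le_iff.1 hle).elim (fun h => ?_) fun h => h.symm
  rw [h] at ht
  exact absurd (by simpa using ht) ht0

theorem IsEssentialSimple.nonempty_equiv {T : Submodule R M} (hT : IsEssentialSimple T)
    [IsSimpleModule R N] {f : N →ₗ[R] M} (hf : f ≠ 0) : Nonempty (N ≃ₗ[R] T) := by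
  obtain ⟨h1, h2⟩ := hT.range_eq hf
  exact ⟨(LinearEquiv.ofInjective f h1).trans (LinearEquiv.ofEq _ _ h2)⟩

theorem IsEssentialSimple.of_equiv {T : Submodule R M} (hT : IsEssentialSimple T)
    (e : M ≃ₗ[R] N) : IsEssentialSimple (T.map (e : M →ₗ[R] N)) := by
  have := hT.simple
  refine ⟨IsSimpleModule.congr (e.submoduleMap T).symm, fun L hL => ?_⟩
  rw [Submodule.map_le_iff_le_comap]
  refine hT.le_of_ne_bot _ fun h => hL ?_
  rw [eq_bot_iff]
  intro x hx
  have : e.symm x ∈ L.comap (e : M →ₗ[R] N) := by simpa using hx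
  rw [h] at this
  simpa using this

/-- Modules with non-isomorphic essential simple submodules, contained in a common
artinian module, are independent: a simple submodule of `⨁ X i` maps nontrivially to only one
`X i`, so it is not in the kernel of the sum map. -/
theorem iSupIndep_of_isEssentialSimple {ι : Type*} [IsArtinian R M] [Finite ι]
    (X : ι → Submodule R M)
    (T : ∀ i, Submodule R (X i)) (hT : ∀ i, IsEssentialSimple (T i))
    (hne : ∀ i j, Nonempty (T i ≃ₗ[R] T j) → i = j) : iSupIndep X := by
  classical
  have := Fintype.ofFinite ι
  let Φ : (∀ i, X i) →ₗ[R] M := ∑ i, (X i).subtype.comp (LinearMap.proj i)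
  have hΦ : LinearMap.ker Φ = ⊥ := by
    by_contra hbot
    obtain ⟨S, hS, hSle⟩ := (eq_bot_or_exists_atom_le (LinearMap.ker Φ)).resolve_left hbot
    have hS' : IsSimpleModule R S := isSimpleModule_iff_isAtom.2 hS
    obtain ⟨s, hs, hs0⟩ := S.ne_bot_iff.1 hS.1
    obtain ⟨i, hi⟩ : ∃ i, s i ≠ 0 := by
      by_contra! h
      exact hs0 (funext h)
    have hpi : ∀ j, s j ≠ 0 → Nonempty (S ≃ₗ[R] T j) := fun j hj =>
      (hT j).nonempty_equiv (f := (LinearMap.proj j).comp S.subtype) fun h =>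
        hj (LinearMap.congr_fun h ⟨s, hs⟩)
    have hz : ∀ j, j ≠ i → s j = 0 := fun j hj => by
      by_contra h
      exact hj (hne _ _ ⟨(hpi j h).some.symm.trans (hpi i hi).some⟩)
    have h1 : Φ s = 0 := hSle hs
    simp only [Φ] at h1
    rw [LinearMap.sum_apply, Finset.sum_eq_single i] at h1
    · exact hi (by simpa using h1)
    · intro j _ hj
      simp [hz j hj]
    · simp
  refine iSupIndep_of_dfinsupp_lsum_injective X ?_
  have : (DFinsupp.lsum ℕ fun i => (X i).subtype) =
      Φ.comp (DFinsupp.linearEquivFunOnFintype (R := R)).toLinearMap := by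
    ext i x
    simp only [Φ, LinearMap.comp_apply, LinearMap.sum_apply]
    rw [Finset.sum_eq_single i]
    · simp
    · intro j _ hj
      simp [hj.symm]
    · simp
  rw [this, LinearMap.coe_comp]
  exact (LinearMap.ker_eq_bot.1 hΦ).comp (LinearEquiv.injective _)

/-- Two finite length projective modules with essential simple submodules and a common simple
quotient have isomorphic essential simple submodules: lifting the quotient maps against each other
gives an endomorphism which is not nilpotent, hence injective by Fitting's lemma. -/
theorem IsEssentialSimple.nonempty_equiv_of_common_quotient [IsNoetherian R M] [IsArtinian R M]
    [Module.Projective R M] [Module.Projective R N] {T : Submodule R M} {S : Submodule R N}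
    (hT : IsEssentialSimple T) (hS : IsEssentialSimple S) [Nontrivial P] {f : M →ₗ[R] P}
    {g : N →ₗ[R] P} (hf : Function.Surjective f) (hg : Function.Surjective g) :
    Nonempty (T ≃ₗ[R] S) := by
  obtain ⟨α, hα⟩ := Module.projective_lifting_property g f hg
  obtain ⟨β, hβ⟩ := Module.projective_lifting_property f g hf
  -- `h` induces the identity on the common quotient `P`, so no power of it vanishes.
  let h : Module.End R M := β.comp α
  have hh : ∀ n, f.comp (h ^ n) = f := by
    intro n
    induction n with
    | zero => rfl
    | succ n ih =>
      rw [pow_succ, Module.End.mul_eq_comp, ← LinearMap.comp_assoc, ih, ← LinearMap.comp_assoc,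
        hβ, hα]
  obtain ⟨n, hn⟩ := Filter.eventually_atTop.1 h.eventually_isCompl_ker_pow_range_pow
  have hc := hn (n + 1) (by omega)
  have hrange : LinearMap.range (h ^ (n + 1)) ≠ ⊥ := by
    intro h0
    rw [LinearMap.range_eq_bot] at h0
    have := hh (n + 1)
    rw [h0, LinearMap.comp_zero] at this
    obtain ⟨p, hp⟩ := exists_ne (0 : P)
    obtain ⟨m, rfl⟩ := hf p
    exact hp (by rw [← this]; rfl)
  have := hT.simple
  obtain ⟨t, ht, ht0⟩ := hT.exists_ne_zero
  have hker : LinearMap.ker (h ^ (n + 1)) = ⊥ := by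
    by_contra hk
    exact ht0 (by simpa using hc.disjoint.le_bot ⟨hT.le_of_ne_bot _ hk ht,
      hT.le_of_ne_bot _ hrange ht⟩)
  refine hS.nonempty_equiv (f := α.comp T.subtype) fun h0 => ht0 ?_
  have h1 : α t = 0 := LinearMap.congr_fun h0 ⟨t, ht⟩
  have h2 : (h ^ (n + 1)) t = 0 := by
    rw [pow_succ]
    simp [h, h1]
  exact LinearMap.ker_eq_bot'.1 hker t h2

end EssentialSimple

/-! ### Idempotents in finite dimensional D-rings -/

/-- Over a finite dimensional left D-ring, every simple module `S` is the essential simple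
submodule of a left ideal `X` such that any left ideal meeting `X` trivially can be enlarged to a
complement of `X`. Among the cyclic modules with essential simple submodule isomorphic to `S`,
take `X` of maximal dimension: `X` embeds in `A` because `A` is a left D-ring, and if `L` is
maximal with `L ∩ X = 0`, then `A ⧸ L` is an essential extension of `X`, so it is no larger
than `X`. -/
theorem IsLeftDRing.exists_complemented (k : Type v) {A : Type u} [Field k] [Ring A] [Algebra k A]
    [Module.Finite k A] (hD : IsLeftDRing A) (S : Type u) [AddCommGroup S]
    [Module A S] [IsSimpleModule A S] :
    ∃ (X : Ideal A) (T : Submodule A X), IsEssentialSimple T ∧ Nonempty (T ≃ₗ[A] S) ∧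
      ∀ L : Ideal A, Disjoint X L → ∃ L', L ≤ L' ∧ IsCompl X L' := by
  have hart : IsNoetherianRing A := isNoetherian_of_tower k inferInstance
  let U : Set (Ideal A) :=
    {K | ∃ T : Submodule A (A ⧸ K), IsEssentialSimple T ∧ Nonempty (T ≃ₗ[A] S)}
  have hfin : ∀ K : Ideal A, Module.Finite k (A ⧸ K) := fun K =>
    Module.Finite.of_surjective (K.mkQ.restrictScalars k) K.mkQ_surjective
  have hU : U.Nonempty := by
    obtain ⟨m, hm, ⟨e⟩⟩ := (isSimpleModule_iff_quot_maximal (R := A) (M := S)).1 inferInstance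
    have hs : IsSimpleModule A (A ⧸ m) := IsSimpleModule.congr e.symm
    refine ⟨m, ⊤, ⟨IsSimpleModule.congr Submodule.topEquiv, fun L hL => ?_⟩,
      ⟨Submodule.topEquiv.trans e.symm⟩⟩
    exact ((eq_bot_or_eq_top L).resolve_left hL).ge
  obtain ⟨K, ⟨T, hT, ⟨e⟩⟩, hK⟩ := WellFounded.has_min
    (measure fun K : Ideal A => Module.finrank k A - Module.finrank k (A ⧸ K)).wf U hU
  have hmax : ∀ L ∈ U, Module.finrank k (A ⧸ L) ≤ Module.finrank k (A ⧸ K) := fun L hL => by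
    have h1 := hK L hL
    have h2 := LinearMap.finrank_le_finrank_of_surjective (f := L.mkQ.restrictScalars k)
      L.mkQ_surjective
    have h3 : ¬ (Module.finrank k A - Module.finrank k (A ⧸ L) <
      Module.finrank k A - Module.finrank k (A ⧸ K)) := h1
    omega
  obtain ⟨t, ht, ht0⟩ := hT.exists_ne_zero
  obtain ⟨a, rfl⟩ := K.mkQ_surjective t
  obtain ⟨x, hx, hax⟩ := hD.exists_mul_ne_zero (I := K) (a := a) fun h => ht0 (by simpa using h)
  let f : (A ⧸ K) →ₗ[A] A := K.liftQ (LinearMap.toSpanSingleton A A x) fun b hb => by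
    simpa using hx b hb
  have hf : Function.Injective f := hT.injective f ht (by simpa [f] using hax)
  obtain ⟨X, ⟨e'⟩⟩ : ∃ X : Ideal A, Nonempty ((A ⧸ K) ≃ₗ[A] X) :=
    ⟨LinearMap.range f, ⟨LinearEquiv.ofInjective f hf⟩⟩
  let T' : Submodule A X := T.map (e' : (A ⧸ K) →ₗ[A] X)
  have hT' : IsEssentialSimple T' := hT.of_equiv e'
  have eT : Nonempty (T' ≃ₗ[A] S) := ⟨(e'.submoduleMap T).symm.trans e⟩
  refine ⟨X, T', hT', eT, fun L hL => ?_⟩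
  obtain ⟨L', ⟨hLL', hL'⟩, hmaxL⟩ := WellFounded.has_min
    (wellFounded_gt : WellFounded ((· > ·) : Ideal A → Ideal A → Prop))
    {L' | L ≤ L' ∧ Disjoint X L'} ⟨L, le_rfl, hL⟩
  refine ⟨L', hLL', hL', ?_⟩
  let p : X →ₗ[A] A ⧸ L' := L'.mkQ.comp X.subtype
  have hp : Function.Injective p := by
    rw [← LinearMap.ker_eq_bot, LinearMap.ker_eq_bot']
    intro y hy
    have : (y : A) ∈ L' := by simpa [p] using hy
    simpa using hL'.le_bot ⟨y.2, this⟩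
  have hL'U : L' ∈ U := by
    have := hT'.simple
    let eq : T' ≃ₗ[A] T'.map p := Submodule.equivMapOfInjective p hp T'
    refine ⟨T'.map p, ⟨IsSimpleModule.congr eq.symm, fun N hN => ?_⟩, ⟨eq.symm.trans eT.some⟩⟩
    rw [Submodule.map_le_iff_le_comap]
    refine hT'.le_of_ne_bot _ fun hbot => ?_
    have hlt : L' < N.comap L'.mkQ := by
      refine lt_of_le_of_ne (fun y hy => by simp [(Submodule.Quotient.mk_eq_zero L').2 hy])
        fun heq => hN ?_
      rw [eq_bot_iff]
      intro y hy
      obtain ⟨y, rfl⟩ := L'.mkQ_surjective y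
      have : y ∈ N.comap L'.mkQ := hy
      rw [← heq] at this
      simpa using this
    refine hmaxL (N.comap L'.mkQ) ⟨hLL'.trans hlt.le, ?_⟩ hlt
    rw [Submodule.disjoint_def]
    intro y hyX hyN
    have : (⟨y, hyX⟩ : X) ∈ N.comap p := hyN
    rw [hbot] at this
    simpa using this
  have hXfin : Module.Finite k X :=
    Module.Finite.of_surjective (e'.toLinearMap.restrictScalars k) e'.surjective
  have hdim : Module.finrank k X = Module.finrank k (A ⧸ L') := by
    refine le_antisymm (LinearMap.finrank_le_finrank_of_injective (f := p.restrictScalars k) hp) ?_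
    rw [← (e'.restrictScalars k).finrank_eq]
    exact hmax L' hL'U
  have hsurj : Function.Surjective (p.restrictScalars k) :=
    (LinearMap.injective_iff_surjective_of_finrank_eq_finrank hdim).1 hp
  rw [codisjoint_iff, eq_top_iff]
  intro b _
  obtain ⟨y, hy⟩ := hsurj (L'.mkQ b)
  have : b - y ∈ L' := (Submodule.Quotient.eq L').1 hy.symm
  rw [← add_sub_cancel (y : A) b]
  exact Submodule.add_mem_sup y.2 this

/-- A noetherian module has, up to isomorphism, finitely many simple submodules. -/
theorem exists_simple_representatives (R : Type u) (M : Type u) [Ring R] [AddCommGroup M]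
    [Module R M] [IsNoetherian R M] :
    ∃ (ι : Type u) (_ : Finite ι) (S : ι → Submodule R M), (∀ i, IsSimpleModule R (S i)) ∧
      (∀ i j, Nonempty (S i ≃ₗ[R] S j) → i = j) ∧
      ∀ N : Submodule R M, IsSimpleModule R N → ∃ i, Nonempty (S i ≃ₗ[R] N) := by
  have hfin : Finite (isotypicComponents R M) :=
    WellFoundedGT.finite_of_sSupIndep (sSupIndep_isotypicComponents R M)
  choose S hS hS' using fun c : isotypicComponents R M => c.2
  refine ⟨isotypicComponents R M, hfin, S, hS, fun i j ⟨e⟩ => ?_, fun N hN => ?_⟩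
  · rw [Subtype.ext_iff, hS', hS', e.isotypicComponent_eq]
  · let c : isotypicComponents R M := ⟨isotypicComponent R M N, N, hN, rfl⟩
    have := hS c
    refine ⟨c, isIsotypicOfType_submodule_iff.1 (.isotypicComponent R M N) (S c) ?_⟩
    rw [show isotypicComponent R M N = isotypicComponent R M (S c) from hS' c]
    exact (S c).le_isotypicComponent

/-- The pairwise orthogonal idempotents `e i` generate left ideals `A (e i)` with essential simple
submodules `T i`; the `T i` are pairwise non-isomorphic, and every simple module is a quotient of
some `A (e i)`. The containment of `L` in `A (e i)` is written as `x * e i = x` for `x ∈ L`, and a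
nonzero map from `A (e i)` to a simple module `S` as an element `s` of `S` with `e i • s ≠ 0`. -/
structure IsBasicFamily {A : Type u} [Ring A] {ι : Type u} (e : ι → A) (T : ι → Ideal A) :
    Prop where
  idem : ∀ i, e i * e i = e i
  ortho : ∀ i j, i ≠ j → e i * e j = 0
  simple : ∀ i, IsSimpleModule A (T i)
  mul_right : ∀ i, ∀ t ∈ T i, t * e i = t
  le_of_ne_bot : ∀ i, ∀ L : Ideal A, L ≠ ⊥ → (∀ x ∈ L, x * e i = x) → T i ≤ L
  noniso : ∀ i j, Nonempty (T i ≃ₗ[A] T j) → i = j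
  exists_smul_ne_zero : ∀ (S : Type u) [AddCommGroup S] [Module A S] [IsSimpleModule A S],
    ∃ i, ∃ s : S, e i • s ≠ 0

/-- The left ideals `X i` with essential simple submodules, one for each isomorphism class of
simple left modules, are independent, and complements `N i` of `X i` containing the other `X j`
provide the orthogonal idempotents. Since the `X i` are projective with pairwise non-isomorphic
socles, their simple quotients are pairwise non-isomorphic, so by counting every simple module
occurs among these. -/
theorem IsLeftDRing.exists_isBasicFamily (k : Type v) {A : Type u} [Field k] [Ring A]
    [Algebra k A] [Module.Finite k A] (hD : IsLeftDRing A) :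
    ∃ (ι : Type u) (_ : Finite ι) (e : ι → A) (T : ι → Ideal A), IsBasicFamily e T := by
  have hnoe : IsNoetherianRing A := isNoetherian_of_tower k inferInstance
  have hart : IsArtinianRing A := isArtinian_of_tower k inferInstance
  obtain ⟨ι, hι, S, hS, hSne, hSrep⟩ := exists_simple_representatives A A
  choose X T hT hTS hX using fun i => hD.exists_complemented k (S i)
  have hTne : ∀ i j, Nonempty (T i ≃ₗ[A] T j) → i = j := fun i j ⟨f⟩ =>
    hSne i j ⟨((hTS i).some.symm.trans f).trans (hTS j).some⟩
  have hrep : ∀ (Q : Type u) [AddCommGroup Q] [Module A Q] [IsSimpleModule A Q],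
      ∃ i, Nonempty (S i ≃ₗ[A] Q) := by
    intro Q _ _ _
    obtain ⟨Y, U, hU, ⟨f⟩, -⟩ := hD.exists_complemented k Q
    have := hU.simple
    let g := Submodule.equivMapOfInjective Y.subtype Y.subtype_injective U
    obtain ⟨i, ⟨h⟩⟩ := hSrep _ (IsSimpleModule.congr g.symm)
    exact ⟨i, ⟨(h.trans g.symm).trans f⟩⟩
  have hind : iSupIndep X := iSupIndep_of_isEssentialSimple X T hT hTne
  choose N hN hc using fun i => hX i _ (hind i)
  let p : ∀ i, A →ₗ[A] X i := fun i => (X i).projectionOnto (N i) (hc i)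
  let e : ι → A := fun i => p i 1
  have hpe : ∀ i x, (p i x : A) = x * e i := fun i x => by
    have : p i (x • 1) = x • p i 1 := map_smul _ _ _
    rw [smul_eq_mul, mul_one] at this
    rw [this]
    rfl
  have hXe : ∀ i, ∀ x ∈ X i, x * e i = x := fun i x hx => by
    rw [← hpe]
    exact congrArg Subtype.val (Submodule.projectionOnto_apply_left (hc i) ⟨x, hx⟩)
  have heX : ∀ i, e i ∈ X i := fun i => (p i 1).2
  have hidem : ∀ i, e i * e i = e i := fun i => hXe i _ (heX i)
  refine ⟨ι, hι, e, fun i => (T i).map (X i).subtype, hidem, fun i j hij => ?_, fun i => ?_,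
    fun i t ht => ?_, fun i L hL hLe => ?_, fun i j ⟨f⟩ => ?_, ?_⟩
  · rw [← hpe]
    have hmem : e i ∈ N j := hN j (Submodule.mem_iSup_of_mem i (Submodule.mem_iSup_of_mem hij
      (heX i)))
    exact congrArg Subtype.val ((Submodule.projectionOnto_apply_eq_zero_iff (hc j)).2 hmem)
  · have := (hT i).simple
    exact IsSimpleModule.congr
      (Submodule.equivMapOfInjective (X i).subtype (X i).subtype_injective (T i)).symm
  · obtain ⟨t, -, rfl⟩ := ht
    exact hXe i _ t.2
  · have hLX : L ≤ X i := fun x hx => by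
      rw [← hLe x hx]
      exact (X i).smul_mem x (heX i)
    rw [Submodule.map_le_iff_le_comap]
    refine (hT i).le_of_ne_bot _ fun h => hL ?_
    rw [eq_bot_iff]
    intro x hx
    have : (⟨x, hLX hx⟩ : X i) ∈ Submodule.comap (X i).subtype L := hx
    rw [h] at this
    simpa using this
  · let g := fun i => Submodule.equivMapOfInjective (X i).subtype (X i).subtype_injective (T i)
    exact hTne i j ⟨((g i).trans f).trans (g j).symm⟩
  · have hnt : ∀ i, Nontrivial (X i) := fun i => by
      obtain ⟨t, -, ht⟩ := (hT i).exists_ne_zero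
      exact ⟨t, 0, ht⟩
    choose m hm using fun i => (eq_top_or_exists_le_coatom (⊥ : Submodule A (X i))).resolve_left
      bot_ne_top
    have hQ : ∀ i, IsSimpleModule A (X i ⧸ m i) := fun i => isSimpleModule_iff_isCoatom.2 (hm i).1
    -- `τ i` is the index of the socle isomorphic to a chosen simple quotient of `X i`.
    choose τ hτ using fun i => hrep (X i ⧸ m i)
    have hproj : ∀ i, Module.Projective A (X i) := fun i =>
      Module.Projective.of_split (X i).subtype (p i) (by
        ext x
        simpa using (hpe i x).trans (hXe i x x.2))
    have hτi : Function.Injective τ := fun i j hij => by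
      have f1 := (hτ i).some
      have f2 := (hτ j).some
      rw [hij] at f1
      have := IsSimpleModule.nontrivial A (X j ⧸ m j)
      exact hTne i j ((hT i).nonempty_equiv_of_common_quotient (hT j)
        (f := (f1.symm.trans f2).toLinearMap.comp (m i).mkQ) (g := (m j).mkQ)
        ((f1.symm.trans f2).surjective.comp (m i).mkQ_surjective) (m j).mkQ_surjective)
    intro Q _ _ _
    obtain ⟨j, ⟨f⟩⟩ := hrep Q
    obtain ⟨i, rfl⟩ := Finite.surjective_of_injective hτi j
    let f' := (hτ i).some.symm.trans f
    refine ⟨i, f' ((m i).mkQ (p i 1)), ?_⟩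
    rw [← map_smul, ← map_smul]
    have h1 : e i • p i 1 = p i 1 := Subtype.ext (hidem i)
    rw [h1]
    intro h0
    rw [LinearEquiv.map_eq_zero_iff, Submodule.mkQ_apply, Submodule.Quotient.mk_eq_zero] at h0
    refine (hm i).1.1 (eq_top_iff.2 fun x _ => ?_)
    have : x = (x : A) • p i 1 := Subtype.ext (hXe i x x.2).symm
    rw [this]
    exact (m i).smul_mem _ h0

section BasicFamily

variable {A : Type u} [Ring A] {ι : Type u} {e : ι → A} {T : ι → Ideal A}

/-- A nonzero left ideal inside `A (∑ e i)` contains one of the `T i`. -/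
theorem IsBasicFamily.exists_le [Fintype ι] [IsArtinianRing A] (h : IsBasicFamily e T)
    {N : Ideal A} (hN : N ≠ ⊥) (hNe : ∀ x ∈ N, x * ∑ i, e i = x) : ∃ i, T i ≤ N := by
  obtain ⟨S, hS, hSN⟩ := (eq_bot_or_exists_atom_le N).resolve_left hN
  have hS' : IsSimpleModule A S := isSimpleModule_iff_isAtom.2 hS
  obtain ⟨s, hs, hs0⟩ := S.ne_bot_iff.1 hS.1
  have key : ∀ i, s * e i ≠ 0 → Nonempty (S ≃ₗ[A] T i) := fun i hi => by
    let f : S →ₗ[A] A := (LinearMap.toSpanSingleton A A (e i)).comp S.subtype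
    have hf0 : f ≠ 0 := fun h0 => hi (by simpa [f] using LinearMap.congr_fun h0 ⟨s, hs⟩)
    have hf : Function.Injective f := (LinearMap.injective_or_eq_zero f).resolve_right hf0
    have hle : T i ≤ LinearMap.range f := by
      refine h.le_of_ne_bot i _ (by rwa [Ne, LinearMap.range_eq_bot]) ?_
      rintro _ ⟨x, rfl⟩
      simp [f, mul_assoc, h.idem]
    have h1 : IsAtom (LinearMap.range f) := isSimpleModule_iff_isAtom.1
      (IsSimpleModule.congr (LinearEquiv.ofInjective f hf).symm)
    have h2 : IsAtom (T i) := isSimpleModule_iff_isAtom.1 (h.simple i)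
    exact ⟨(LinearEquiv.ofInjective f hf).trans
      (LinearEquiv.ofEq _ _ ((h1.le_iff_eq h2.1).1 hle).symm)⟩
  obtain ⟨i, hi⟩ : ∃ i, s * e i ≠ 0 := by
    by_contra! h0
    apply hs0
    rw [← hNe s (hSN hs), Finset.mul_sum]
    exact Finset.sum_eq_zero fun i _ => h0 i
  have hz : ∀ j, j ≠ i → s * e j = 0 := fun j hj => by
    by_contra h0
    exact hj (h.noniso _ _ ⟨(key j h0).some.symm.trans (key i hi).some⟩)
  have hse : s * e i = s := by
    conv_rhs => rw [← hNe s (hSN hs), Finset.mul_sum]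
    rw [Finset.sum_eq_single i (fun j _ hj => hz j hj) (by simp)]
  refine ⟨i, (h.le_of_ne_bot i (Ideal.span {s}) (by simpa) fun x hx => ?_).trans
    ((Ideal.span_singleton_le_iff_mem _).2 (hSN hs))⟩
  obtain ⟨a, rfl⟩ := Ideal.mem_span_singleton'.1 hx
  rw [mul_assoc, hse]

theorem IsBasicFamily.sum_mul_self [Fintype ι] (h : IsBasicFamily e T) (i : ι) :
    (∑ j, e j) * e i = e i := by
  rw [Finset.sum_mul, Finset.sum_eq_single i (fun j _ hj => h.ortho j i hj) (by simp), h.idem]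

theorem IsBasicFamily.self_mul_sum [Fintype ι] (h : IsBasicFamily e T) (i : ι) :
    e i * ∑ j, e j = e i := by
  rw [Finset.mul_sum, Finset.sum_eq_single i (fun j _ hj => h.ortho i j hj.symm) (by simp),
    h.idem]

/-- The idempotent `∑ e i` is full: it generates `A` as a two-sided ideal. The left ideal spanned by
`(∑ e i) A` is this two-sided ideal; if it lay in a maximal left ideal `m`, all the `e i` would
annihilate the simple module `A ⧸ m`. -/
theorem IsBasicFamily.span_eq_top [Fintype ι] (h : IsBasicFamily e T) :
    Ideal.span {x | ∃ b, x = (∑ i, e i) * b} = ⊤ := by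
  by_contra hne
  obtain ⟨m, hm, hle⟩ := Ideal.exists_le_maximal _ hne
  have : IsSimpleModule A (A ⧸ m) := isSimpleModule_iff_isCoatom.2 hm.1
  obtain ⟨i, s, hs⟩ := h.exists_smul_ne_zero (A ⧸ m)
  obtain ⟨b, rfl⟩ := m.mkQ_surjective s
  apply hs
  rw [← map_smul, Submodule.mkQ_apply, Submodule.Quotient.mk_eq_zero, smul_eq_mul,
    ← h.sum_mul_self i, mul_assoc]
  exact hle (Ideal.subset_span ⟨_, rfl⟩)

theorem IsBasicFamily.sum_mul_sum [Fintype ι] (h : IsBasicFamily e T) :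
    (∑ i, e i) * ∑ i, e i = ∑ i, e i := by
  conv_lhs => rw [Finset.mul_sum]
  exact Finset.sum_congr rfl fun i _ => h.sum_mul_self i

/-- A linear functional `φ` on `A` that is nonzero on the left socle of `A (∑ e i)`; the pairing
`(x, y) ↦ φ (y x)` of `A (∑ e i)` with `(∑ e i) A` then has trivial left radical. -/
theorem IsBasicFamily.exists_functional (k : Type v) [Field k] [Algebra k A] [Fintype ι]
    [IsArtinianRing A] (h : IsBasicFamily e T) :
    ∃ φ : A →ₗ[k] k, ∀ x, x * ∑ i, e i = x → (∀ a, φ ((∑ i, e i) * a * x) = 0) → x = 0 := by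
  set ε := ∑ i, e i with hε
  have hv : ∀ i, ∃ v ∈ T i, ε * v = v ∧ v ≠ 0 := fun i => by
    by_contra! h0
    have := h.simple i
    have := IsSimpleModule.nontrivial A (T i)
    obtain ⟨⟨t, ht⟩, ht0⟩ := exists_ne (0 : T i)
    have hle : Ideal.span {x | ∃ b, x = ε * b} ≤
        LinearMap.ker (LinearMap.toSpanSingleton A A t) := by
      rw [Ideal.span_le]
      rintro _ ⟨b, rfl⟩
      have hmem : ε * b * t ∈ T i := (T i).mul_mem_left _ ht
      simpa using h0 _ hmem (by rw [← mul_assoc, ← mul_assoc, h.sum_mul_sum])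
    rw [h.span_eq_top] at hle
    exact ht0 (Subtype.ext (by simpa using hle (Submodule.mem_top : (1 : A) ∈ ⊤)))
  choose v hvT hεv hv0 using hv
  have hψ : ∀ i, ∃ ψ : A →ₗ[k] k, ψ (v i) ≠ 0 := fun i => by
    by_contra! h0
    exact hv0 i ((Module.forall_dual_apply_eq_zero_iff k (v i)).1 h0)
  choose ψ hψ using hψ
  -- `T i ⊆ A (e i)`, so right multiplication by `e j` fixes `v j` and kills the other `v i`.
  let φ : A →ₗ[k] k := ∑ i, (ψ i).comp (LinearMap.mulRight k (e i))
  have hφ : ∀ i, φ (v i) ≠ 0 := fun i => by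
    have : φ (v i) = ψ i (v i) := by
      simp only [φ, LinearMap.sum_apply, LinearMap.comp_apply, LinearMap.mulRight_apply]
      rw [Finset.sum_eq_single i, h.mul_right i _ (hvT i)]
      · intro j _ hj
        rw [← h.mul_right i _ (hvT i), mul_assoc, h.ortho i j hj.symm, mul_zero, map_zero]
      · simp
    rw [this]
    exact hψ i
  refine ⟨φ, fun x hx hx0 => ?_⟩
  let N : Ideal A :=
    { carrier := {x | x * ε = x ∧ ∀ a, φ (ε * a * x) = 0}
      zero_mem' := by simp
      add_mem' := fun {x y} hx hy => ⟨by rw [add_mul, hx.1, hy.1], fun a => by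
        rw [mul_add, map_add, hx.2, hy.2, add_zero]⟩
      smul_mem' := fun c x hx => ⟨by rw [smul_eq_mul, mul_assoc, hx.1], fun a => by
        rw [smul_eq_mul, ← mul_assoc, mul_assoc ε, hx.2]⟩ }
  by_contra hne
  have hN : N ≠ ⊥ := fun h0 => hne (by
    have : x ∈ N := ⟨hx, hx0⟩
    rwa [h0] at this)
  obtain ⟨i, hi⟩ := h.exists_le hN fun x hx => hx.1
  have := (hi (hvT i)).2 1
  rw [mul_one, hεv] at this
  exact hφ i this

end BasicFamily

/-! ### Finite dimensional D-rings are self-injective -/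

/-- If the pairing `(x, y) ↦ φ (y x)` on `A ε × ε A` has trivial left radical and `ε` is a full
idempotent, it is a perfect pairing: it restricts to a pairing of `ε A ε` with itself, which is
perfect because both sides have the same dimension, and this kills the right radical. -/
theorem exists_representing_element (k : Type v) {A : Type u} [Field k] [Ring A] [Algebra k A]
    [Module.Finite k A] {ε : A} (hid : ε * ε = ε)
    (hfull : Ideal.span {x | ∃ b, x = ε * b} = ⊤) (φ : A →ₗ[k] k)
    (hφ : ∀ x, x * ε = x → (∀ a, φ (ε * a * x) = 0) → x = 0) (μ : A →ₗ[k] k) :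
    ∃ z, z * ε = z ∧ ∀ a, φ (ε * a * z) = μ (ε * a) := by
  let U : Submodule k A := LinearMap.range (LinearMap.mulRight k ε)
  let V : Submodule k A := LinearMap.range (LinearMap.mulLeft k ε)
  have hU : ∀ x ∈ U, x * ε = x := by
    rintro _ ⟨a, rfl⟩
    simp [mul_assoc, hid]
  have hV : ∀ x ∈ V, ε * x = x := by
    rintro _ ⟨a, rfl⟩
    simp [← mul_assoc, hid]
  have hU' : ∀ x, x * ε = x → x ∈ U := fun x hx => ⟨x, hx⟩
  have hV' : ∀ x, ε * x = x → x ∈ V := fun x hx => ⟨x, hx⟩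
  let β : ∀ P Q : Submodule k A, P →ₗ[k] Q →ₗ[k] k := fun P Q =>
    ((LinearMap.mul k A).flip.compr₂ φ).domRestrict₁₂ P Q
  have hβ : ∀ (P Q : Submodule k A) (x : P) (y : Q), β P Q x y = φ (y * x) := fun _ _ _ _ => rfl
  have hleft : Function.Injective (β U V) := by
    rw [← LinearMap.ker_eq_bot, LinearMap.ker_eq_bot']
    intro x hx
    refine Subtype.ext (hφ x (hU x x.2) fun a => ?_)
    exact LinearMap.congr_fun hx ⟨ε * a, a, rfl⟩
  have hcorner : Function.Injective (β (U ⊓ V) (U ⊓ V)) := by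
    rw [← LinearMap.ker_eq_bot, LinearMap.ker_eq_bot']
    intro x hx
    refine Subtype.ext (hφ x (hU x x.2.1) fun a => ?_)
    rw [← hV x x.2.2, ← mul_assoc]
    exact LinearMap.congr_fun hx ⟨ε * a * ε, ⟨ε * a, rfl⟩, hV' _ (by simp [← mul_assoc, hid])⟩
  have hcorner' : Function.Surjective (β (U ⊓ V) (U ⊓ V)) :=
    (LinearMap.injective_iff_surjective_of_finrank_eq_finrank
      Subspace.dual_finrank_eq.symm).1 hcorner
  have hright : Function.Injective (β U V).flip := by
    rw [← LinearMap.ker_eq_bot, LinearMap.ker_eq_bot']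
    intro y hy
    have hy0 : ∀ x, x * ε = x → φ (y * x) = 0 := fun x hx =>
      LinearMap.congr_fun hy ⟨x, hU' x hx⟩
    have hz : ∀ a, y * a * ε = 0 := fun a => by
      have hm : (y : A) * a * ε ∈ U ⊓ V :=
        ⟨⟨_, rfl⟩, hV' _ (by rw [← mul_assoc, ← mul_assoc, hV y y.2])⟩
      have h0 : (⟨_, hm⟩ : ↥(U ⊓ V)) = 0 := by
        rw [← Module.forall_dual_apply_eq_zero_iff k]
        intro f
        obtain ⟨d, rfl⟩ := hcorner' f
        rw [hβ]
        simp only [mul_assoc]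
        exact hy0 _ (by simp only [mul_assoc, hU d d.2.1])
      exact congrArg Subtype.val h0
    let W : Ideal A :=
      { carrier := {x | ∀ a, y * a * x = 0}
        zero_mem' := by simp
        add_mem' := fun {x x'} hx hx' a => by rw [mul_add, hx a, hx' a, add_zero]
        smul_mem' := fun c x hx a => by rw [smul_eq_mul, ← mul_assoc, mul_assoc (y : A), hx] }
    have hW : W = ⊤ := by
      rw [eq_top_iff, ← hfull, Ideal.span_le]
      rintro _ ⟨b, rfl⟩ a
      rw [← mul_assoc, hz, zero_mul]
    have h1 := (hW ▸ Submodule.mem_top : (1 : A) ∈ W) 1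
    exact Subtype.ext (by simpa using h1)
  have hsurj : Function.Surjective (β U V) :=
    (LinearMap.injective_iff_surjective_of_finrank_eq_finrank (by
      rw [Subspace.dual_finrank_eq]
      refine le_antisymm ?_ ?_
      · rw [← Subspace.dual_finrank_eq (V := V)]
        exact LinearMap.finrank_le_finrank_of_injective hleft
      · rw [← Subspace.dual_finrank_eq (V := U)]
        exact LinearMap.finrank_le_finrank_of_injective hright)).1 hleft
  obtain ⟨z, hz⟩ := hsurj (μ.comp V.subtype)
  exact ⟨z, hU z z.2, fun a => LinearMap.congr_fun hz ⟨ε * a, a, rfl⟩⟩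

theorem IsLeftDRing.injective (k : Type v) {A : Type u} [Field k] [Ring A] [Algebra k A]
    [Module.Finite k A] (hD : IsLeftDRing A) : Module.Injective A A := by
  have hart : IsArtinianRing A := isArtinian_of_tower k inferInstance
  obtain ⟨ι, hι, e, T, h⟩ := hD.exists_isBasicFamily k
  have := Fintype.ofFinite ι
  obtain ⟨φ, hφ⟩ := h.exists_functional k
  have hid := h.sum_mul_sum
  have hfull := h.span_eq_top
  set ε := ∑ i, e i
  apply Module.Baer.injective
  intro I g
  -- The maps `I → A ε` obtained from `g` extend to right multiplications.
  have hext : ∀ u, ∃ z, ∀ a (ha : a ∈ I), g ⟨a, ha⟩ * u * ε = a * z := by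
    intro u
    let gu : I →ₗ[A] A := (LinearMap.toSpanSingleton A A (u * ε)).comp g
    -- Composing with `φ` gives a `k`-linear functional on `I`; extend it to `A` and represent it.
    obtain ⟨μ, hμ⟩ := LinearMap.exists_extend (p := I.restrictScalars k)
      (φ.comp (gu.restrictScalars k))
    obtain ⟨z, hz, hz'⟩ := exists_representing_element k hid hfull φ hφ μ
    refine ⟨z, fun a ha => ?_⟩
    rw [← sub_eq_zero]
    apply hφ
    · simp only [sub_mul, mul_assoc, hid, hz]
    · intro b
      have h1 : ε * b * (a * z) = ε * (b * a) * z := by simp only [mul_assoc]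
      have h2 : ε * (b * a) ∈ I := I.mul_mem_left _ (I.mul_mem_left _ ha)
      have h3 : (⟨ε * (b * a), h2⟩ : I) = (ε * b) • ⟨a, ha⟩ := Subtype.ext (by simp [mul_assoc])
      have h4 : μ (ε * (b * a)) = φ (gu ⟨ε * (b * a), h2⟩) :=
        LinearMap.congr_fun hμ (⟨ε * (b * a), h2⟩ : I)
      rw [mul_sub, map_sub, h1, hz', h4, h3, map_smul]
      simp [gu, mul_assoc]
  -- The right multipliers `w` for which `a ↦ g a * w` extends form a left ideal containing `ε A`.
  let W : Ideal A :=
    { carrier := {w | ∀ u, ∃ z, ∀ a (ha : a ∈ I), g ⟨a, ha⟩ * u * w = a * z}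
      zero_mem' := fun u => ⟨0, by simp⟩
      add_mem' := fun {w w'} hw hw' u => by
        obtain ⟨z, hz⟩ := hw u
        obtain ⟨z', hz'⟩ := hw' u
        exact ⟨z + z', fun a ha => by rw [mul_add, mul_add, hz a ha, hz' a ha]⟩
      smul_mem' := fun c w hw u => by
        obtain ⟨z, hz⟩ := hw (u * c)
        exact ⟨z, fun a ha => by rw [smul_eq_mul, ← hz a ha]; simp only [mul_assoc]⟩ }
  have hW : W = ⊤ := by
    rw [eq_top_iff, ← hfull, Ideal.span_le]
    rintro _ ⟨b, rfl⟩ u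
    obtain ⟨z, hz⟩ := hext u
    exact ⟨z * b, fun a ha => by rw [← mul_assoc, ← mul_assoc, hz a ha]⟩
  obtain ⟨z, hz⟩ := (hW ▸ Submodule.mem_top : (1 : A) ∈ W) 1
  exact ⟨LinearMap.toSpanSingleton A A z, fun a ha => by simpa using (hz a ha).symm⟩

/-! ### Profinite algebras -/

section Profinite

variable {k : Type v} {A : Type u} [Field k] [Ring A] [Algebra k A]

theorem IsProfiniteAlgebra.op (hA : IsProfiniteAlgebra k A) : IsProfiniteAlgebra k Aᵐᵒᵖ := by
  obtain ⟨ι, _, hdir, hne, B, _, _, f, hfin, hf, ⟨E⟩⟩ := hA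
  have hE : ∀ a ⦃i j : ι⦄ (h : i ≤ j), f h ((E a).1 j) = (E a).1 i := fun a => (E a).2
  let g : Aᵐᵒᵖ →ₐ[k] algInverseLimit k (fun i => (B i)ᵐᵒᵖ) fun i j h => (f h).op :=
    { toFun := fun a => ⟨fun i => .op ((E a.unop).1 i), fun i j h =>
        congrArg MulOpposite.op (hE _ h)⟩
      map_one' := by ext; simp
      map_mul' := fun a b => by ext; simp
      map_zero' := by ext; simp
      map_add' := fun a b => by ext; simp
      commutes' := fun r => by ext; simp }
  refine ⟨ι, _, hdir, hne, fun i => (B i)ᵐᵒᵖ, inferInstance, inferInstance,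
    fun i j h => (f h).op, fun i => inferInstance, ⟨fun i x => ?_, fun i j l h h' x => ?_⟩,
    ⟨AlgEquiv.ofBijective g ⟨fun a b hab => ?_, fun x => ?_⟩⟩⟩
  · exact congrArg MulOpposite.op (hf.map_self x.unop)
  · exact congrArg MulOpposite.op (hf.map_map h h' x.unop)
  · apply MulOpposite.unop_injective
    apply E.injective
    ext i
    exact congrArg MulOpposite.unop (congrFun (congrArg Subtype.val hab) i)
  · refine ⟨.op (E.symm ⟨fun i => (x.1 i).unop, fun i j h =>
      congrArg MulOpposite.unop (x.2 h)⟩), ?_⟩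
    ext i
    simp [g]

/-- A profinite algebra has a directed system of projections to finite dimensional algebras, which
separate the elements and are such that every compatible family comes from an element. -/
theorem IsProfiniteAlgebra.exists_projections (hA : IsProfiniteAlgebra k A) :
    ∃ (ι : Type u) (_ : Preorder ι) (_ : IsDirectedOrder ι) (_ : Nonempty ι) (B : ι → Type u)
      (_ : ∀ i, Ring (B i)) (_ : ∀ i, Algebra k (B i)) (f : ∀ ⦃i j : ι⦄, i ≤ j → B j →ₐ[k] B i)
      (π : ∀ i, A →ₐ[k] B i), (∀ i, Module.Finite k (B i)) ∧
      (∀ ⦃i j⦄ (h : i ≤ j) a, f h (π j a) = π i a) ∧ (∀ a, (∀ i, π i a = 0) → a = 0) ∧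
      ∀ b : ∀ i, B i, (∀ ⦃i j⦄ (h : i ≤ j), f h (b j) = b i) → ∃ a, ∀ i, π i a = b i := by
  obtain ⟨ι, _, hdir, hne, B, _, _, f, hfin, hf, ⟨E⟩⟩ := hA
  refine ⟨ι, _, hdir, hne, B, _, _, f, fun i => (Pi.evalAlgHom k B i).comp
    ((Subalgebra.val _).comp E.toAlgHom), hfin, fun i j h a => (E a).2 h, fun a ha => ?_,
    fun b hb => ⟨E.symm ⟨b, hb⟩, fun i => ?_⟩⟩
  · rw [← map_eq_zero_iff E E.injective]
    ext i
    exact ha i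
  · simp

/-- A linear functional taking the value `1` on each of countably many vectors in echelon form. -/
theorem exists_dual_eq_one_of_echelon (v : ℕ → ℕ → k) (h0 : ∀ m n, n < m → v m n = 0)
    (h1 : ∀ n, v n n ≠ 0) : ∃ G : (ℕ → k) →ₗ[k] k, ∀ n, G (v n) = 1 := by
  have hli : LinearIndependent k v := by
    rw [linearIndependent_iff']
    intro s c hc
    by_contra! hne
    obtain ⟨i, ⟨his, hi⟩, hmin⟩ := WellFounded.has_min (wellFounded_lt (α := ℕ))
      {i | i ∈ s ∧ c i ≠ 0} hne
    have h2 := congrFun hc i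
    rw [Finset.sum_apply, Finset.sum_eq_single i] at h2
    · exact (mul_ne_zero hi (h1 i)) h2
    · intro j hj hji
      rcases lt_or_gt_of_ne hji with hlt | hlt
      · have : c j = 0 := by
          by_contra hcj
          exact hmin j ⟨hj, hcj⟩ hlt
        simp [this]
      · simp [h0 j i hlt]
    · exact fun h => absurd his h
  obtain ⟨G, hG⟩ := LinearMap.exists_extend ((Module.Basis.span hli).constr k fun _ => (1 : k))
  refine ⟨G, fun n => ?_⟩
  have h2 := LinearMap.congr_fun hG (Module.Basis.span hli n)
  rw [Module.Basis.constr_basis] at h2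
  rw [← h2, LinearMap.comp_apply, Submodule.subtype_apply, Module.Basis.span_apply]

/-- A profinite left D-ring `A` is left noetherian. Left ideals are annihilators, hence cut out by
continuous functionals, and every linear functional on the space of continuous functionals is
evaluation at an element of `A`. For a strictly increasing chain `L n`, choose continuous `w n`
vanishing on `L n` but not on `L (n + 1)`; these are independent modulo the functionals vanishing
on `⋃ n, L n`, so some `a ∈ ⋃ n, L n` has `w n a = 1` for all `n`, contradicting `a ∈ L n`. -/
theorem IsLeftDRing.isNoetherianRing (hA : IsProfiniteAlgebra k A) (hD : IsLeftDRing A) :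
    IsNoetherianRing A := by
  obtain ⟨ι, _, hdir, hne, B, _, _, f, π, hfin, hf, hinj, hsurj⟩ := hA.exists_projections
  have hsep : ∀ (L : Ideal A) (a : A), a ∉ L → ∃ (i : ι) (w : Module.Dual k (B i)),
      (∀ b ∈ L, w (π i b) = 0) ∧ w (π i a) ≠ 0 := by
    intro L a ha
    obtain ⟨x, hx, hax⟩ := hD.exists_mul_ne_zero ha
    obtain ⟨i, hi⟩ : ∃ i, π i (a * x) ≠ 0 := by
      by_contra! h
      exact hax (hinj _ h)
    obtain ⟨w, hw⟩ : ∃ w : Module.Dual k (B i), w (π i (a * x)) ≠ 0 := by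
      by_contra! h
      exact hi ((Module.forall_dual_apply_eq_zero_iff k _).1 h)
    refine ⟨i, w.comp (LinearMap.mulRight k (π i x)), fun b hb => ?_, ?_⟩
    · simp [← map_mul, hx b hb]
    · simpa [← map_mul] using hw
  -- Reflexivity of the `B i` gives a compatible family, hence an element of `A`.
  have hrep : ∀ F : Module.Dual k A →ₗ[k] k, ∃ a, ∀ (i : ι) (w : Module.Dual k (B i)),
      w (π i a) = F (w.comp (π i).toLinearMap) := by
    intro F
    have hb : ∀ i, ∃ b : B i, ∀ w : Module.Dual k (B i),
        w b = F (w.comp (π i).toLinearMap) := fun i => by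
      obtain ⟨b, hb⟩ := (Module.evalEquiv k (B i)).surjective
        (F.comp (π i).toLinearMap.dualMap)
      exact ⟨b, fun w => LinearMap.congr_fun hb w⟩
    choose b hb using hb
    obtain ⟨a, ha⟩ := hsurj b fun i j h => by
      rw [← sub_eq_zero, ← Module.forall_dual_apply_eq_zero_iff k]
      intro w
      have h1 := hb j (w.comp (f h).toLinearMap)
      have h2 : (w.comp (f h).toLinearMap).comp (π j).toLinearMap =
          w.comp (π i).toLinearMap := by
        ext a
        simp [hf h a]
      rw [h2, ← hb i w] at h1
      rw [map_sub, sub_eq_zero]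
      exact h1
    exact ⟨a, fun i w => by rw [ha, hb]⟩
  rw [IsNoetherianRing, isNoetherian_iff', WellFoundedGT, isWellFounded_iff,
    RelEmbedding.wellFounded_iff_isEmpty]
  refine ⟨fun L => ?_⟩
  have hlt : ∀ {m n}, m < n → L m < L n := fun h => L.map_rel_iff.2 h
  have hle : ∀ {m n}, m ≤ n → L m ≤ L n := fun h =>
    h.eq_or_lt.elim (fun h => h ▸ le_rfl) fun h => (hlt h).le
  choose a ha ha' using fun n => SetLike.exists_of_lt (hlt (Nat.lt_succ_self n))
  choose i w hw hwa using fun n => hsep (L n) (a n) (ha' n)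
  obtain ⟨G, hG⟩ := exists_dual_eq_one_of_echelon (fun m n => w m (π (i m) (a n)))
    (fun m n h => hw m _ (hle h (ha n))) hwa
  -- The functional `w ↦ G (n ↦ w (a n))` takes the value `1` at each `w n`.
  obtain ⟨x, hx⟩ := hrep (G.comp (LinearMap.pi fun n => Module.Dual.eval k A (a n)))
  have hmem : x ∈ ⨆ n, L n := by
    by_contra hxL
    obtain ⟨j, w', hw', hw'x⟩ := hsep _ x hxL
    apply hw'x
    rw [hx, LinearMap.comp_apply, ← map_zero G]
    congr 1
    ext n
    exact hw' _ (Submodule.mem_iSup_of_mem (n + 1) (ha n))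
  obtain ⟨n, hn⟩ := (Submodule.mem_iSup_of_directed _ (directed_of_isDirected_le
    fun _ _ h => hle h)).1 hmem
  have h1 : w n (π (i n) x) = 1 := (hx (i n) (w n)).trans (hG n)
  rw [hw n x hn] at h1
  exact zero_ne_one h1

/-- The right annihilators `r (Iᵢ)` of the open ideals `Iᵢ` (the kernels of the projections) form
a directed family of left ideals; by noetherianity it has a largest element, and as `Iᵢ` is the left
annihilator of `r (Iᵢ)`, the corresponding `Iᵢ` is contained in all the others, hence zero. -/
theorem IsLeftDRing.module_finite (hA : IsProfiniteAlgebra k A) (hD : IsLeftDRing A) :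
    Module.Finite k A := by
  have hnoe := hD.isNoetherianRing hA
  obtain ⟨ι, _, hdir, hne, B, _, _, f, π, hfin, hf, hinj, -⟩ := hA.exists_projections
  let r : ι → Ideal A := fun i =>
    { carrier := {x | ∀ a, π i a = 0 → a * x = 0}
      zero_mem' := by simp
      add_mem' := fun {x y} hx hy a ha => by rw [mul_add, hx a ha, hy a ha, add_zero]
      smul_mem' := fun c x hx a ha => by
        rw [smul_eq_mul, ← mul_assoc, hx _ (by rw [map_mul, ha, zero_mul])] }
  have hr : ∀ {i j}, i ≤ j → r i ≤ r j := fun {i j} h x hx a ha =>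
    hx a (by rw [← hf h, ha, map_zero])
  obtain ⟨_, ⟨i, rfl⟩, hi⟩ := WellFounded.has_min
    (wellFounded_gt : WellFounded ((· > ·) : Ideal A → Ideal A → Prop)) (Set.range r)
    (Set.range_nonempty r)
  have hmax : ∀ j, r j ≤ r i := fun j => by
    obtain ⟨l, hil, hjl⟩ := exists_ge_ge i j
    rcases (hr hil).eq_or_lt with h | h
    · exact h ▸ hr hjl
    · exact absurd h (hi _ ⟨l, rfl⟩)
  refine Module.Finite.of_injective (π i).toLinearMap ?_
  rw [← LinearMap.ker_eq_bot, LinearMap.ker_eq_bot']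
  intro a ha
  refine hinj a fun j => ?_
  by_contra hj
  obtain ⟨x, hx, hax⟩ := hD.exists_mul_ne_zero (I := RingHom.ker (π j)) (a := a) hj
  exact hax (hmax j (fun b hb => hx b hb) a ha)

theorem IsProfiniteAlgebra.module_finite_of_isArtinianRing (hA : IsProfiniteAlgebra k A)
    [IsArtinianRing A] : Module.Finite k A := by
  obtain ⟨ι, _, hdir, hne, B, _, _, f, π, hfin, hf, hinj, -⟩ := hA.exists_projections
  obtain ⟨_, ⟨i, rfl⟩, hi⟩ := WellFounded.has_min
    (wellFounded_lt : WellFounded ((· < ·) : Ideal A → Ideal A → Prop))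
    (Set.range fun i => RingHom.ker (π i)) (Set.range_nonempty _)
  have hle : ∀ {i j}, i ≤ j → RingHom.ker (π j) ≤ RingHom.ker (π i) := fun {i j} h x hx => by
    rw [RingHom.mem_ker] at hx ⊢
    rw [← hf h, hx, map_zero]
  refine Module.Finite.of_injective (π i).toLinearMap ?_
  rw [← LinearMap.ker_eq_bot, LinearMap.ker_eq_bot']
  intro a ha
  refine hinj a fun j => ?_
  obtain ⟨l, hil, hjl⟩ := exists_ge_ge i j
  rcases (hle hil).eq_or_lt with h | h
  · have : a ∈ RingHom.ker (π l) := h ▸ ha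
    exact hle hjl this
  · exact absurd h (hi _ ⟨l, rfl⟩)

/-- The direct sum of the finite dimensional quotients `A ⧸ Iᵢ` by open ideals is a faithful module
in which every element is killed by some `Iᵢ`. If it generates `A`, then some `Iᵢ` kills a
preimage of `1`, so `Iᵢ = 0`. -/
theorem IsLeftPF.module_finite (hA : IsProfiniteAlgebra k A) (h : IsLeftPF A) :
    Module.Finite k A := by
  classical
  obtain ⟨ι, _, hdir, hne, B, _, _, f, π, hfin, hf, hinj, -⟩ := hA.exists_projections
  have hle : ∀ {i j}, i ≤ j → ∀ a, π j a = 0 → π i a = 0 := fun {i j} h a ha => by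
    rw [← hf h, ha, map_zero]
  -- Hiding the definition of `I i` keeps the ring structure of `A ⧸ ker (π i)` out of the way.
  obtain ⟨I, hI⟩ : ∃ I : ι → Ideal A, ∀ i a, a ∈ I i ↔ π i a = 0 :=
    ⟨fun i => RingHom.ker (π i), fun i a => RingHom.mem_ker⟩
  obtain ⟨M, _, _, _, hMi⟩ : ∃ (M : Type u) (_ : AddCommGroup M) (_ : Module A M),
      FaithfulSMul A M ∧ ∀ m : M, ∃ i, ∀ a, π i a = 0 → a • m = 0 := by
    refine ⟨Π₀ i, A ⧸ I i, inferInstance, inferInstance, ⟨fun {a b} hab => ?_⟩, fun m => ?_⟩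
    · rw [← sub_eq_zero]
      refine hinj _ fun i => ?_
      have h1 := DFunLike.congr_fun (hab (DFinsupp.single i ((I i).mkQ 1))) i
      rw [DFinsupp.smul_apply, DFinsupp.smul_apply, DFinsupp.single_eq_same, ← map_smul,
        ← map_smul] at h1
      have h2 := (Submodule.Quotient.eq _).1 h1
      rw [hI] at h2
      simpa using h2
    · induction m using DFinsupp.induction with
      | h0 => exact ⟨hne.some, fun a _ => smul_zero a⟩
      | ha i b m _ _ ih =>
        obtain ⟨j, hj⟩ := ih
        obtain ⟨l, hil, hjl⟩ := exists_ge_ge i j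
        refine ⟨l, fun a ha => ?_⟩
        obtain ⟨c, rfl⟩ := (I i).mkQ_surjective b
        have h1 : a • (I i).mkQ c = 0 := by
          rw [← map_smul, Submodule.mkQ_apply, Submodule.Quotient.mk_eq_zero, hI,
            smul_eq_mul, map_mul, hle hil a ha, zero_mul]
        refine (smul_add a _ m).trans ?_
        rw [hj a (hle hjl a ha), ← DFinsupp.single_smul, h1, DFinsupp.single_zero, add_zero]
  obtain ⟨J, g, hg⟩ := h M A
  obtain ⟨y, hy⟩ := hg 1
  have hyi : ∀ y : J →₀ M, ∃ i, ∀ a, π i a = 0 → a • y = 0 := by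
    intro y
    induction y using Finsupp.induction_linear with
    | zero => exact ⟨hne.some, fun a _ => smul_zero a⟩
    | add y z hy hz =>
      obtain ⟨i, hi⟩ := hy
      obtain ⟨j, hj⟩ := hz
      obtain ⟨l, hil, hjl⟩ := exists_ge_ge i j
      exact ⟨l, fun a ha => by
        rw [smul_add, hi a (hle hil a ha), hj a (hle hjl a ha), add_zero]⟩
    | single j m =>
      obtain ⟨i, hi⟩ := hMi m
      exact ⟨i, fun a ha => by rw [Finsupp.smul_single, hi a ha, Finsupp.single_zero]⟩
  obtain ⟨i, hi⟩ := hyi y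
  refine Module.Finite.of_injective (π i).toLinearMap ?_
  rw [← LinearMap.ker_eq_bot, LinearMap.ker_eq_bot']
  intro a ha
  have h1 : g (a • y) = a := by rw [map_smul, hy, smul_eq_mul, mul_one]
  rw [← h1, hi a ha, map_zero]

end Profinite

/-! ### Left-right symmetry and the equivalences -/

theorem Module.Finite.of_mulOpposite {k : Type v} {A : Type u} [Field k] [Ring A] [Algebra k A]
    (h : Module.Finite k Aᵐᵒᵖ) : Module.Finite k A :=
  Module.Finite.equiv (MulOpposite.opLinearEquiv k : A ≃ₗ[k] Aᵐᵒᵖ).symm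

/-- A finite dimensional left self-injective algebra is a right D-ring, hence right
self-injective. -/
theorem Module.Injective.mulOpposite (k : Type v) {A : Type u} [Field k] [Ring A] [Algebra k A]
    [Module.Finite k A] (h : Module.Injective A A) : Module.Injective Aᵐᵒᵖ Aᵐᵒᵖ := by
  have : IsNoetherianRing Aᵐᵒᵖ := isNoetherian_of_tower k inferInstance
  exact (isLeftDRing_op_of_injective h).injective k

theorem isLeftDRing_of_injective_op (k : Type v) {A : Type u} [Field k] [Ring A] [Algebra k A]
    [Module.Finite k A] (h : Module.Injective Aᵐᵒᵖ Aᵐᵒᵖ) : IsLeftDRing A := by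
  have : IsNoetherianRing Aᵐᵒᵖᵐᵒᵖ := isNoetherian_of_tower k inferInstance
  exact (isLeftDRing_op_of_injective h).of_ringEquiv (RingEquiv.opOp A).symm

theorem theorem4p6 (k : Type v) (A : Type u) [Field k] [Ring A] [Algebra k A]
    (hA : IsProfiniteAlgebra k A) :
    List.TFAE [
      IsLeftPF A,
      IsRightPF A,
      IsLeftCogenerator A,
      IsRightCogenerator A,
      IsQF A,
      Module.Finite k A ∧ IsQF A,
      IsLeftFGF A,
      IsRightFGF A,
      IsLeftCF A,
      IsRightCF A,
      IsLeftDRing A,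
      IsRightDRing A] := by
  have hop := hA.op
  tfae_have 6 → 5 := And.right
  tfae_have 5 → 6 := fun h =>
    ⟨h.2.elim (fun _ => hA.module_finite_of_isArtinianRing)
      fun _ => hop.module_finite_of_isArtinianRing.of_mulOpposite, h⟩
  tfae_have 7 → 9 := IsLeftFGF.isLeftCF
  tfae_have 8 → 10 := IsLeftFGF.isLeftCF
  tfae_have 9 → 11 := IsLeftCF.isLeftDRing
  tfae_have 10 → 12 := IsLeftCF.isLeftDRing
  tfae_have 3 → 11 := IsLeftCogenerator.isLeftDRing
  tfae_have 4 → 12 := IsLeftCogenerator.isLeftDRing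
  tfae_have 11 → 6 := fun h => by
    have hfin := h.module_finite hA
    exact ⟨hfin, Or.inl (h.injective k), Or.inl (isArtinian_of_tower k inferInstance)⟩
  tfae_have 12 → 6 := fun h => by
    have hfin : Module.Finite k A := (IsLeftDRing.module_finite hop h).of_mulOpposite
    exact ⟨hfin, Or.inr (IsLeftDRing.injective k h), Or.inl (isArtinian_of_tower k inferInstance)⟩
  tfae_have 1 → 6 := fun h => by
    have hfin := h.module_finite hA
    exact ⟨hfin, Or.inl h.injective, Or.inl (isArtinian_of_tower k inferInstance)⟩
  tfae_have 2 → 6 := fun h => by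
    have hfin : Module.Finite k A := (IsLeftPF.module_finite hop h).of_mulOpposite
    exact ⟨hfin, Or.inr (IsLeftPF.injective h), Or.inl (isArtinian_of_tower k inferInstance)⟩
  have key : Module.Finite k A ∧ IsQF A → IsArtinianRing A ∧ IsArtinianRing Aᵐᵒᵖ ∧
      Module.Injective A A ∧ Module.Injective Aᵐᵒᵖ Aᵐᵒᵖ ∧ IsLeftDRing A ∧ IsLeftDRing Aᵐᵒᵖ := by
    rintro ⟨hfin, hinj, -⟩
    have hr : Module.Injective Aᵐᵒᵖ Aᵐᵒᵖ := hinj.elim (fun h => h.mulOpposite k) id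
    have hl := isLeftDRing_of_injective_op k hr
    have hli := hl.injective k
    have hnoe : IsNoetherianRing Aᵐᵒᵖ := isNoetherian_of_tower k inferInstance
    exact ⟨isArtinian_of_tower k inferInstance, isArtinian_of_tower k inferInstance, hli, hr, hl,
      isLeftDRing_op_of_injective hli⟩
  tfae_have 6 → 1 := fun h => by
    obtain ⟨_, _, hl, hr, hDl, hDr⟩ := key h
    exact isLeftPF_of_injective hl
  tfae_have 6 → 2 := fun h => by
    obtain ⟨_, _, hl, hr, hDl, hDr⟩ := key h
    exact isLeftPF_of_injective hr
  tfae_have 6 → 3 := fun h => by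
    obtain ⟨_, _, hl, hr, hDl, hDr⟩ := key h
    exact hDl.isLeftCogenerator hl
  tfae_have 6 → 4 := fun h => by
    obtain ⟨_, _, hl, hr, hDl, hDr⟩ := key h
    exact hDr.isLeftCogenerator hr
  tfae_have 6 → 7 := fun h => by
    obtain ⟨_, _, hl, hr, hDl, hDr⟩ := key h
    exact hDl.isLeftFGF hl
  tfae_have 6 → 8 := fun h => by
    obtain ⟨_, _, hl, hr, hDl, hDr⟩ := key h
    exact hDr.isLeftFGF hr
  tfae_finish
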